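/- **Theorem.** An abstract polytope of rank $n$ (an $n$-polytope) is a partially ordered set $\mathcal P$ with a least and a greatest element, all of whose maximal chains (*flags*) have $n+2$ elements, so that its elements (*faces*) have well-defined ranks from $-1$ (the least face) to $n$ (the greatest face), and which satisfies: (i) if $F<G$ and $\operatorname{rank}G-\operatorname{rank}F=2$, then there are exactly two faces $H$ with $\operatorname{rank} H=\operatorname{rank}F+1$ and $F<H<G$; (ii) if $F<G$ and $\operatorname{rank}G-\operatorname{rank}F\ge 3$, then any two faces strictly between $F$ and $G$ are joined by a finite sequence of faces strictly between $F$ and $G$ in which consecutive faces are comparable. Faces of rank $0$ and $n-1$ are called vertices and facets. A facet $F$ is also regarded as the $(n-1)$-polytope $\{H : H\le F\}$, and the vertex-figure at a vertex $v$ is the $(n-1)$-polytope $\{H : H\ge v\}$. Two flags are adjacent if they differ in exactly one element. Let $\Gamma(\mathcal P)$ be the group of order-automorphisms of $\mathcal P$. Then $\mathcal P$ is *regular* if $\Gamma(\mathcal P)$ is transitive on the flags; *chiral* if $\Gamma(\mathcal P)$ has exactly two orbits on the flags and adjacent flags always lie in different orbits; and *flat* if every facet is incident with (i.e. comparable to)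 every vertex. There is no chiral polytope (of any rank, finite or infinite) all of whose facets are flat, finite and regular and all of whose vertex-figures are finite and regular. -/

import Mathlib

/-- The rank of a face `x`: the minimal face has rank `-1`, the faces covering it have rank `0`, and
so on. (`Order.height x` is the length of the longest chain `⊥ < ⋯ < x`; in a poset whose maximal
chains all have the same finite length, all saturated chains from `⊥` to `x` have this length.) -/
noncomputable def faceRank {P : Type*} [PartialOrder P] (x : P) : ℤ :=
  ((Order.height x).toNat : ℤ) - 1

/-- `P` is an abstract polytope of rank `n`. -/
structure IsAbstractPolytope (n : ℤ) (P : Type*) [PartialOrder P] [BoundedOrder P] : Prop where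
  /-- All maximal chains have the same length, and the maximal face has rank `n`: every flag has
  exactly one face of each of the ranks `-1, 0, …, n`. -/
  flag_card : ∀ Φ : Flag P, (Φ : Set P).Finite ∧ ((Φ : Set P).ncard : ℤ) = n + 2
  /-- The diamond condition. -/
  diamond : ∀ F G : P, F < G → faceRank G - faceRank F = 2 →
    {H : P | faceRank H = faceRank F + 1 ∧ F < H ∧ H < G}.encard = 2
  /-- Strong connectivity: any two faces strictly between `F` and `G` are joined by a sequence of
  successively comparable faces strictly between `F` and `G`. -/
  strongly_connected : ∀ F G : P, F < G → 3 ≤ faceRank G - faceRank F →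
    ∀ H H' : Set.Ioo F G, Relation.ReflTransGen (fun X Y => X ≤ Y ∨ Y ≤ X) H H'

/-- Two flags are adjacent if they differ in exactly one element. -/
def FlagAdjacent {P : Type*} [PartialOrder P] (Φ Ψ : Flag P) : Prop :=
  ((Φ : Set P) \ Ψ).encard = 1 ∧ ((Ψ : Set P) \ Φ).encard = 1

/-- Two flags lie in the same orbit under the automorphism group of `P`. -/
def SameFlagOrbit {P : Type*} [PartialOrder P] (Φ Ψ : Flag P) : Prop :=
  ∃ γ : P ≃o P, Flag.map γ Φ = Ψ

/-- Regularity: the automorphism group is transitive on the flags. -/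
def IsRegularPolytope (P : Type*) [PartialOrder P] : Prop :=
  ∀ Φ Ψ : Flag P, SameFlagOrbit Φ Ψ

/-- Chirality: the automorphism group has exactly two orbits on the flags, and adjacent flags lie
in different orbits. -/
def IsChiralPolytope (P : Type*) [PartialOrder P] : Prop :=
  (∃ Φ₁ Φ₂ : Flag P, ¬ SameFlagOrbit Φ₁ Φ₂ ∧
    ∀ Ψ : Flag P, SameFlagOrbit Φ₁ Ψ ∨ SameFlagOrbit Φ₂ Ψ) ∧
  ∀ Φ Ψ : Flag P, FlagAdjacent Φ Ψ → ¬ SameFlagOrbit Φ Ψ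

/-- Flatness of an `n`-polytope: every facet (face of rank `n - 1`) is incident with every vertex
(face of rank `0`). -/
def IsFlatPolytope (n : ℤ) (P : Type*) [PartialOrder P] : Prop :=
  ∀ F v : P, faceRank F = n - 1 → faceRank v = 0 → v ≤ F ∨ F ≤ v

/-! Faces are indexed by height (rank plus one), so that vertices have height 1, facets height `N -
1`, and `N = n + 1`. Let `r_i` be the permutation of the flags exchanging each flag with its
`i`-adjacent flag, and let `conn a b` be the group generated by the `r_i` with `a < i < b`.
Automorphisms commute with every `r_i`. The plan is to show that `conn 0 N` acts freely on the
flags. The polytope is then regular (`exists_orderIso_of_free`), contradicting the existence of two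
orbits.

Let `w` lie in the facet group `conn 0 (N - 1)` and fix a flag `f`. Regularity of the facet forces
`w` to fix the adjacent flag `adj 1 f` as well. By chirality `f` and `adj 1 f` represent both
orbits, so `w = 1`. The same argument applies to the vertex-figure group `conn 1 N`
(`conn_eq_one_of_section`).

Flatness of the facets gives `conn 0 (N - 1) = conn 1 (N - 1) * conn 0 (N - 2)`. Since `r_{N-1}`
commutes with `conn 0 (N - 2)`, this extends to `conn 0 N = conn 1 N * conn 0 (N - 2)`. If `w = b *
d` in this form fixes a flag `f`, then `f` and `d f` share their vertex and their facet, so `d f = c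
f` for some `c` in `conn 1 (N - 1)`. Freeness of the facet group gives `d = c`, so `w = b * c` lies
in the vertex-figure group and fixes `f`; hence `w = 1`. -/

/-- A flag of a bounded poset listed in increasing order: `face k` is its face of height `k`, for
`k ≤ N`. -/
structure RankedFlag (N : ℕ) (P : Type*) [PartialOrder P] [BoundedOrder P] where
  /-- The face of height `k`, and `⊤` for `N ≤ k`. -/
  face : ℕ → P
  face_lt : ∀ {k l : ℕ}, k < l → l ≤ N → face k < face l
  face_top : ∀ {k : ℕ}, N ≤ k → face k = ⊤

/-- All flags of `P` have `N + 1` elements. -/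
def AllFlagsHaveLength (N : ℕ) (P : Type*) [PartialOrder P] : Prop :=
  ∀ Φ : Flag P, (Φ : Set P).Finite ∧ (Φ : Set P).ncard = N + 1

/-! ### Flags as height-indexed chains. -/

namespace RankedFlag

variable {N : ℕ} {P : Type*} [PartialOrder P] [BoundedOrder P]

theorem face_mono (f : RankedFlag N P) {k l : ℕ} (h : k ≤ l) : f.face k ≤ f.face l := by
  by_cases hl : l ≤ N
  · rcases h.eq_or_lt with rfl | h
    · exact le_rfl
    · exact (f.face_lt h hl).le
  · rw [f.face_top (k := l) (by omega)]
    exact le_top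

theorem ext_face {f g : RankedFlag N P} (h : ∀ k ≤ N, f.face k = g.face k) : f = g := by
  have : f.face = g.face := by
    funext k
    by_cases hk : k ≤ N
    · exact h k hk
    · rw [f.face_top (by omega), g.face_top (by omega)]
  cases f; cases g; simp_all

theorem face_injOn (f : RankedFlag N P) : Set.InjOn f.face (Set.Iic N) := by
  intro k hk l hl h
  rcases lt_trichotomy k l with h' | h' | h'
  · exact absurd h (f.face_lt h' hl).ne
  · exact h'
  · exact absurd h (f.face_lt h' hk).ne'

theorem isChain_range (f : RankedFlag N P) : IsChain (· ≤ ·) (Set.range f.face) := by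
  rintro _ ⟨k, rfl⟩ _ ⟨l, rfl⟩ _
  rcases le_total k l with h | h
  · exact Or.inl (f.face_mono h)
  · exact Or.inr (f.face_mono h)

theorem range_eq_image (f : RankedFlag N P) : Set.range f.face = f.face '' Set.Iic N := by
  ext x
  constructor
  · rintro ⟨k, rfl⟩
    rcases le_total k N with h | h
    · exact ⟨k, h, rfl⟩
    · exact ⟨N, Set.mem_Iic.2 le_rfl, by rw [f.face_top h, f.face_top le_rfl]⟩
  · rintro ⟨k, _, rfl⟩
    exact ⟨k, rfl⟩

theorem isMaxChain_range (hN : AllFlagsHaveLength N P) (f : RankedFlag N P) :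
    IsMaxChain (· ≤ ·) (Set.range f.face) := by
  obtain ⟨M, hM, hsub⟩ := f.isChain_range.exists_maxChain
  obtain ⟨hfin, hcard⟩ := hN (Flag.ofIsMaxChain M hM)
  simp only [Flag.coe_ofIsMaxChain] at hfin hcard
  have hc : (Set.range f.face).ncard = N + 1 := by
    rw [range_eq_image, f.face_injOn.ncard_image]
    simp [Set.ncard_eq_toFinset_card']
  have : Set.range f.face = M := Set.eq_of_subset_of_ncard_le hsub (by omega) hfin
  exact this ▸ hM

/-- The flag underlying a ranked flag. -/
def toFlag (hN : AllFlagsHaveLength N P) (f : RankedFlag N P) : Flag P :=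
  Flag.ofIsMaxChain _ (f.isMaxChain_range hN)

theorem coe_toFlag (hN : AllFlagsHaveLength N P) (f : RankedFlag N P) :
    (f.toFlag hN : Set P) = Set.range f.face := rfl

theorem exists_toFlag_eq (hN : AllFlagsHaveLength N P) (Φ : Flag P) :
    ∃ f : RankedFlag N P, f.toFlag hN = Φ := by
  classical
  obtain ⟨hfin, hcard⟩ := hN Φ
  let _ : Fintype Φ := hfin.fintype
  have hc : Fintype.card Φ = N + 1 := by
    rw [← hcard, ← Nat.card_coe_set_eq, Nat.card_eq_fintype_card]
    rfl
  let e : Fin (N + 1) ≃o Φ := Fintype.orderIsoFinOfCardEq Φ hc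
  have htop : e (Fin.last N) = ⊤ := by
    have := e.map_top
    rwa [Fin.top_eq_last] at this
  let f : RankedFlag N P :=
    { face := fun k => if h : k < N + 1 then (e ⟨k, h⟩ : P) else ⊤
      face_lt := by
        intro k l hkl hl
        rw [dif_pos (by omega), dif_pos (by omega)]
        exact Subtype.coe_lt_coe.2 (e.strictMono (by simpa using hkl))
      face_top := by
        intro k hk
        by_cases h : k < N + 1
        · obtain rfl : k = N := by omega
          rw [dif_pos h]
          exact congrArg Subtype.val htop
        · rw [dif_neg h] }
  refine ⟨f, Flag.ext ?_⟩
  rw [coe_toFlag]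
  ext x
  constructor
  · rintro ⟨k, rfl⟩
    by_cases h : k < N + 1
    · simp only [f, dif_pos h]
      exact (e ⟨k, h⟩).2
    · simp only [f, dif_neg h]
      exact Φ.top_mem
  · intro hx
    refine ⟨e.symm ⟨x, hx⟩, ?_⟩
    simp only [f, dif_pos (e.symm ⟨x, hx⟩).2, Fin.eta, OrderIso.apply_symm_apply]

theorem exists_of_isChain (hN : AllFlagsHaveLength N P) {C : Set P} (hC : IsChain (· ≤ ·) C) :
    ∃ f : RankedFlag N P, ∀ x ∈ C, ∃ k ≤ N, f.face k = x := by
  obtain ⟨M, hM, hsub⟩ := hC.exists_maxChain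
  obtain ⟨f, hf⟩ := exists_toFlag_eq hN (Flag.ofIsMaxChain M hM)
  have hf' : Set.range f.face = M := by rw [← coe_toFlag hN, hf]; rfl
  refine ⟨f, fun x hx => ?_⟩
  have := hsub hx
  rw [← hf', range_eq_image] at this
  exact this

/-- A longer chain ending at `f.face k`, continued by the faces of `f` above it, would have more
than `N + 1` elements. The faces of `f` themselves give the lower bound. -/
theorem height_face (hN : AllFlagsHaveLength N P) (f : RankedFlag N P) {k : ℕ} (hk : k ≤ N) :
    Order.height (f.face k) = k := by
  classical
  apply le_antisymm
  · apply Order.height_le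
    intro p hp
    have hle : ∀ i, p i ≤ f.face k := fun i => hp ▸ p.strictMono.monotone (Fin.le_last i)
    let C : Finset P := Finset.univ.image p ∪ (Finset.Ioc k N).image f.face
    have hdisj : Disjoint (Finset.univ.image p) ((Finset.Ioc k N).image f.face) := by
      rw [Finset.disjoint_left]
      intro x hx hx'
      simp only [Finset.mem_image, Finset.mem_univ, true_and, Finset.mem_Ioc] at hx hx'
      obtain ⟨i, rfl⟩ := hx
      obtain ⟨l, hl, h⟩ := hx'
      exact absurd (f.face_lt hl.1 hl.2) (by rw [h]; exact (hle i).not_gt)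
    have hCcard : C.card = p.length + 1 + (N - k) := by
      rw [Finset.card_union_of_disjoint hdisj, Finset.card_image_of_injective _ p.strictMono.injective,
        Finset.card_image_of_injOn]
      · simp
      · exact f.face_injOn.mono fun l hl => (Finset.mem_Ioc.1 hl).2
    have hchain : IsChain (· ≤ ·) (C : Set P) := by
      intro x hx y hy _
      simp only [C, Finset.coe_union, Finset.coe_image, Set.mem_union, Set.mem_image,
        Finset.coe_univ, Set.mem_univ, true_and, Finset.coe_Ioc, Set.mem_Ioc] at hx hy
      rcases hx with ⟨i, rfl⟩ | ⟨i, hi, rfl⟩ <;> rcases hy with ⟨j, rfl⟩ | ⟨j, hj, rfl⟩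
      · rcases le_total i j with h | h
        · exact Or.inl (p.strictMono.monotone h)
        · exact Or.inr (p.strictMono.monotone h)
      · exact Or.inl ((hle i).trans (f.face_mono hj.1.le))
      · exact Or.inr ((hle j).trans (f.face_mono hi.1.le))
      · rcases le_total i j with h | h
        · exact Or.inl (f.face_mono h)
        · exact Or.inr (f.face_mono h)
    obtain ⟨M, hM, hsub⟩ := hchain.exists_maxChain
    obtain ⟨hfin, hcard⟩ := hN (Flag.ofIsMaxChain M hM)
    simp only [Flag.coe_ofIsMaxChain] at hfin hcard
    have := Set.ncard_le_ncard hsub hfin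
    rw [Set.ncard_coe_finset] at this
    have : p.length ≤ k := by omega
    exact_mod_cast this
  · let p : LTSeries P :=
      { length := k
        toFun := fun i => f.face i
        step := fun i => f.face_lt (by simp) (by simp; omega) }
    exact Order.length_le_height (p := p) le_rfl

theorem faceRank_face (hN : AllFlagsHaveLength N P) (f : RankedFlag N P) {k : ℕ} (hk : k ≤ N) :
    faceRank (f.face k) = (k : ℤ) - 1 := by
  rw [faceRank, f.height_face hN hk]
  rfl

theorem index_unique (hN : AllFlagsHaveLength N P) {f g : RankedFlag N P} {k l : ℕ} (hk : k ≤ N)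
    (hl : l ≤ N) (h : f.face k = g.face l) : k = l := by
  have h1 := f.height_face hN hk
  rw [h, g.height_face hN hl] at h1
  exact_mod_cast h1.symm

theorem face_zero (hN : AllFlagsHaveLength N P) (f : RankedFlag N P) : f.face 0 = ⊥ := by
  have := f.height_face hN (Nat.zero_le N)
  simpa using this

theorem exists_face_eq (hN : AllFlagsHaveLength N P) (x : P) :
    ∃ f : RankedFlag N P, ∃ k ≤ N, f.face k = x := by
  obtain ⟨f, hf⟩ := exists_of_isChain hN (Set.subsingleton_singleton (a := x)).isChain
  exact ⟨f, hf x rfl⟩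

theorem ext_of_range_subset (hN : AllFlagsHaveLength N P) {f g : RankedFlag N P}
    (h : ∀ k ≤ N, ∃ l, g.face l = f.face k) : f = g := by
  apply ext_face
  intro k hk
  have : f.face k ∈ Set.range g.face := h k hk
  rw [range_eq_image] at this
  obtain ⟨l, hl, h⟩ := this
  rw [← h, index_unique hN hl hk h]

/-- There is a ranked flag that agrees with `f` outside the open interval `(a, b)` and passes
through prescribed comparable faces in between. -/
theorem exists_through (hN : AllFlagsHaveLength N P) (f : RankedFlag N P) {a b : ℕ}
    {x y : P} (hax : f.face a ≤ x) (hxy : x ≤ y) (hyb : y ≤ f.face b) :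
    ∃ g : RankedFlag N P, (∀ k, k ≤ a ∨ b ≤ k → g.face k = f.face k) ∧
      (∃ k ≤ N, g.face k = x) ∧ ∃ k ≤ N, g.face k = y := by
  have hchain : IsChain (· ≤ ·) ({z | z = x ∨ z = y ∨ ∃ k, (k ≤ a ∨ b ≤ k) ∧ f.face k = z}) := by
    have key : ∀ k, (k ≤ a ∨ b ≤ k) → ∀ z, f.face a ≤ z → z ≤ f.face b →
        (f.face k ≤ z ∨ z ≤ f.face k) := by
      rintro k (hk | hk) z h1 h2
      · exact Or.inl ((f.face_mono hk).trans h1)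
      · exact Or.inr (h2.trans (f.face_mono hk))
    have hxb := hxy.trans hyb
    have hay := hax.trans hxy
    rintro z (rfl | rfl | ⟨k, hk, rfl⟩) w (rfl | rfl | ⟨l, hl, rfl⟩) _
    · exact Or.inl le_rfl
    · exact Or.inl hxy
    · exact (key l hl _ hax hxb).symm
    · exact Or.inr hxy
    · exact Or.inl le_rfl
    · exact (key l hl _ hay hyb).symm
    · exact key k hk _ hax hxb
    · exact key k hk _ hay hyb
    · rcases le_total k l with h | h
      · exact Or.inl (f.face_mono h)
      · exact Or.inr (f.face_mono h)
  obtain ⟨g, hg⟩ := exists_of_isChain hN hchain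
  refine ⟨g, fun k hk => ?_, hg x (Or.inl rfl), hg y (Or.inr (Or.inl rfl))⟩
  by_cases hkN : k ≤ N
  · obtain ⟨l, hl, h⟩ := hg (f.face k) (Or.inr (Or.inr ⟨k, hk, rfl⟩))
    rw [← h, index_unique hN hl hkN h]
  · rw [g.face_top (by omega), f.face_top (by omega)]

/-- Two ranked flags sharing the face of height `c` can be spliced there. -/
theorem exists_splice {f g : RankedFlag N P} {c : ℕ}
    (h : f.face c = g.face c) :
    ∃ e : RankedFlag N P, (∀ k ≤ c, e.face k = f.face k) ∧ ∀ k, c ≤ k → e.face k = g.face k := by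
  refine ⟨⟨fun k => if k ≤ c then f.face k else g.face k, ?_, ?_⟩, ?_, ?_⟩
  · intro k l hkl hl
    split_ifs with h1 h2
    · exact f.face_lt hkl hl
    · exact ((f.face_mono h1).trans_eq h).trans_lt (g.face_lt (by omega) hl)
    · omega
    · exact g.face_lt hkl hl
  · intro k hk
    split_ifs
    · exact f.face_top hk
    · exact g.face_top hk
  · intro k hk
    exact if_pos hk
  · intro k hk
    change (if k ≤ c then f.face k else g.face k) = _
    split_ifs
    · rw [show k = c by omega, h]
    · rfl

end RankedFlag

/-! ### Adjacent flags. -/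

namespace RankedFlag

variable {N : ℕ} {P : Type*} [PartialOrder P] [BoundedOrder P]

theorem _root_.IsAbstractPolytope.allFlagsHaveLength
    (hP : IsAbstractPolytope ((N : ℤ) - 1) P) : AllFlagsHaveLength N P := by
  intro Φ
  obtain ⟨h1, h2⟩ := hP.flag_card Φ
  exact ⟨h1, by omega⟩

open Classical in
/-- The `i`-adjacent flag: the flag other than `f` with the same faces except for the face of
height `i` (and `f` itself if there is none). -/
noncomputable def adj (i : ℕ) (f : RankedFlag N P) : RankedFlag N P :=
  if h : ∃ g : RankedFlag N P, g ≠ f ∧ ∀ k, k ≠ i → g.face k = f.face k then h.choose else f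

theorem adj_face {i k : ℕ} (f : RankedFlag N P) (hk : k ≠ i) :
    (adj i f).face k = f.face k := by
  unfold adj
  split_ifs with h
  · exact h.choose_spec.2 k hk
  · rfl

theorem face_ne_of_ne {i : ℕ} {f g : RankedFlag N P} (hne : g ≠ f)
    (h : ∀ k, k ≠ i → g.face k = f.face k) : g.face i ≠ f.face i := by
  intro hi
  apply hne
  apply ext_face
  intro k _
  by_cases hk : k = i
  · rw [hk, hi]
  · exact h k hk

theorem encard_between (hP : IsAbstractPolytope ((N : ℤ) - 1) P) (f : RankedFlag N P) {i : ℕ}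
    (h0 : 0 < i) (hi : i < N) :
    {H : P | faceRank H = (i : ℤ) - 1 ∧ f.face (i - 1) < H ∧ H < f.face (i + 1)}.encard = 2 := by
  have hN := hP.allFlagsHaveLength
  have h1 := f.faceRank_face hN (k := i - 1) (by omega)
  have h2 := f.faceRank_face hN (k := i + 1) (by omega)
  have := hP.diamond (f.face (i - 1)) (f.face (i + 1)) (f.face_lt (by omega) (by omega))
    (by rw [h1, h2]; omega)
  rw [h1] at this
  convert! this using 5
  omega

theorem face_mem_between (hP : IsAbstractPolytope ((N : ℤ) - 1) P) {f g : RankedFlag N P} {i : ℕ}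
    (h0 : 0 < i) (hi : i < N) (h : ∀ k, k ≠ i → g.face k = f.face k) :
    g.face i ∈ {H : P | faceRank H = (i : ℤ) - 1 ∧ f.face (i - 1) < H ∧ H < f.face (i + 1)} := by
  refine ⟨g.faceRank_face hP.allFlagsHaveLength hi.le, ?_, ?_⟩
  · rw [← h (i - 1) (by omega)]
    exact g.face_lt (by omega) hi.le
  · rw [← h (i + 1) (by omega)]
    exact g.face_lt (by omega) hi

theorem exists_adjacent (hP : IsAbstractPolytope ((N : ℤ) - 1) P) (f : RankedFlag N P) {i : ℕ}
    (h0 : 0 < i) (hi : i < N) :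
    ∃ g : RankedFlag N P, g ≠ f ∧ ∀ k, k ≠ i → g.face k = f.face k := by
  have hmem := face_mem_between hP (f := f) (g := f) h0 hi fun _ _ => rfl
  have hcard := encard_between hP f h0 hi
  obtain ⟨x, y, hxy, hS⟩ := Set.encard_eq_two.1 hcard
  obtain ⟨z, hz, hzne⟩ : ∃ z ∈ {H : P | faceRank H = (i : ℤ) - 1 ∧ f.face (i - 1) < H ∧
      H < f.face (i + 1)}, z ≠ f.face i := by
    rw [hS]
    by_cases hx : x = f.face i
    · exact ⟨y, by simp, hx ▸ hxy.symm⟩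
    · exact ⟨x, by simp, hx⟩
  refine ⟨⟨fun k => if k = i then z else f.face k, ?_, ?_⟩, ?_, ?_⟩
  · intro k l hkl hl
    split_ifs with h1 h2 h2
    · omega
    · exact hz.2.2.trans_le (f.face_mono (by omega))
    · exact (f.face_mono (by omega)).trans_lt hz.2.1
    · exact f.face_lt hkl hl
  · intro k hk
    rw [if_neg (by omega), f.face_top hk]
  · intro h
    apply hzne
    have := congrArg (fun g => RankedFlag.face g i) h
    simpa using this
  · intro k hk
    exact if_neg hk

/-- The diamond condition leaves two candidates for the face of height `i`, and `f` occupies one. At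
heights `0` and `≥ N` the face is forced, so no such `g` exists. -/
theorem eq_adj (hP : IsAbstractPolytope ((N : ℤ) - 1) P) {f g : RankedFlag N P} {i : ℕ}
    (hne : g ≠ f) (h : ∀ k, k ≠ i → g.face k = f.face k) : g = adj i f := by
  have hN := hP.allFlagsHaveLength
  have hex : ∃ g : RankedFlag N P, g ≠ f ∧ ∀ k, k ≠ i → g.face k = f.face k := ⟨g, hne, h⟩
  have hadj : adj i f ≠ f := by
    unfold adj
    rw [dif_pos hex]
    exact hex.choose_spec.1
  have hgi := face_ne_of_ne hne h
  have hai := face_ne_of_ne hadj fun k hk => adj_face f hk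
  by_cases h0 : 0 < i
  · by_cases hi : i < N
    · obtain ⟨x, y, hxy, hS⟩ := Set.encard_eq_two.1 (encard_between hP f h0 hi)
      have m1 := face_mem_between hP (f := f) (g := f) h0 hi fun _ _ => rfl
      have m2 := face_mem_between hP h0 hi h
      have m3 := face_mem_between hP (g := adj i f) h0 hi fun k hk => adj_face f hk
      rw [hS] at m1 m2 m3
      apply ext_face
      intro k _
      by_cases hk : k = i
      · subst hk
        simp only [Set.mem_insert_iff, Set.mem_singleton_iff] at m1 m2 m3
        grind
      · rw [h k hk, adj_face f hk]
    · exact absurd ((g.face_top (by omega)).trans (f.face_top (by omega)).symm) hgi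
  · obtain rfl : i = 0 := by omega
    exact absurd ((g.face_zero hN).trans (f.face_zero hN).symm) hgi

theorem adj_ne (hP : IsAbstractPolytope ((N : ℤ) - 1) P) (f : RankedFlag N P) {i : ℕ}
    (h0 : 0 < i) (hi : i < N) : adj i f ≠ f := by
  obtain ⟨g, hne, h⟩ := exists_adjacent hP f h0 hi
  exact eq_adj hP hne h ▸ hne

theorem adj_eq_self (hP : IsAbstractPolytope ((N : ℤ) - 1) P) (f : RankedFlag N P) {i : ℕ}
    (hi : ¬(0 < i ∧ i < N)) : adj i f = f := by
  have hN := hP.allFlagsHaveLength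
  refine ext_face fun k hk => ?_
  by_cases hki : k = i
  · rcases Nat.eq_zero_or_pos k with h0 | h0
    · rw [h0, face_zero hN, face_zero hN]
    · rw [face_top _ (by omega), face_top _ (by omega)]
  · exact adj_face f hki

theorem adj_involutive (hP : IsAbstractPolytope ((N : ℤ) - 1) P) (i : ℕ) :
    Function.Involutive (adj i : RankedFlag N P → RankedFlag N P) := by
  intro f
  by_cases h : adj i f = f
  · rw [h, h]
  · exact (eq_adj hP (Ne.symm h) fun k hk => (adj_face f hk).symm).symm

/-- Both sides equal the splice of `adj i f` and `adj j f` at height `i + 1`, a face that neither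
change touches. -/
theorem adj_comm (hP : IsAbstractPolytope ((N : ℤ) - 1) P) {i j : ℕ} (h0 : 0 < i)
    (hij : i + 1 < j) (hj : j < N) (f : RankedFlag N P) : adj i (adj j f) = adj j (adj i f) := by
  obtain ⟨e, he1, he2⟩ := exists_splice (f := adj i f) (g := adj j f) (c := i + 1)
    (by rw [adj_face f (by omega), adj_face f (by omega)])
  have hi' := face_ne_of_ne (adj_ne hP f h0 (i := i) (by omega)) fun k hk => adj_face f hk
  have hj' := face_ne_of_ne (adj_ne hP f (i := j) (by omega) hj) fun k hk => adj_face f hk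
  trans e
  · refine (eq_adj hP ?_ ?_).symm
    · intro h
      apply hi'
      rw [← he1 i (by omega), h, adj_face f (by omega)]
    · intro k hk
      rcases le_total k (i + 1) with h | h
      · rw [he1 k h, adj_face f hk, adj_face f (by omega)]
      · exact he2 k h
  · refine eq_adj hP ?_ ?_
    · intro h
      apply hj'
      rw [← he2 j (by omega), h, adj_face f (by omega)]
    · intro k hk
      rcases le_total k (i + 1) with h | h
      · exact he1 k h
      · rw [he2 k h, adj_face f hk, adj_face f (by omega)]

/-! ### The connection group and strong connectivity. -/

/-- The permutation of the flags that takes each flag to its `i`-adjacent flag. -/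
noncomputable def adjPerm (hP : IsAbstractPolytope ((N : ℤ) - 1) P) (i : ℕ) :
    Equiv.Perm (RankedFlag N P) := (adj_involutive hP i).toPerm

@[simp] theorem adjPerm_apply (hP : IsAbstractPolytope ((N : ℤ) - 1) P) (i : ℕ)
    (f : RankedFlag N P) : adjPerm hP i f = adj i f := rfl

theorem adjPerm_inv (hP : IsAbstractPolytope ((N : ℤ) - 1) P) (i : ℕ) :
    (adjPerm hP i)⁻¹ = adjPerm hP i := (adj_involutive hP i).toPerm_symm

/-- The subgroup of the connection group generated by the adjacency permutations at heights
strictly between `a` and `b`. -/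
def conn (hP : IsAbstractPolytope ((N : ℤ) - 1) P) (a b : ℕ) :
    Subgroup (Equiv.Perm (RankedFlag N P)) :=
  Subgroup.closure {σ | ∃ i, a < i ∧ i < b ∧ adjPerm hP i = σ}

theorem adjPerm_mem_conn (hP : IsAbstractPolytope ((N : ℤ) - 1) P) {a b i : ℕ} (ha : a < i)
    (hb : i < b) : adjPerm hP i ∈ conn hP a b :=
  Subgroup.subset_closure ⟨i, ha, hb, rfl⟩

theorem conn_mono (hP : IsAbstractPolytope ((N : ℤ) - 1) P) {a b a' b' : ℕ} (ha : a' ≤ a)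
    (hb : b ≤ b') : conn hP a b ≤ conn hP a' b' := by
  apply Subgroup.closure_mono
  rintro _ ⟨i, h1, h2, rfl⟩
  exact ⟨i, by omega, by omega, rfl⟩

theorem conn_induction_left (hP : IsAbstractPolytope ((N : ℤ) - 1) P) {a b : ℕ}
    {p : Equiv.Perm (RankedFlag N P) → Prop} (one : p 1)
    (mul : ∀ i w, a < i → i < b → w ∈ conn hP a b → p w → p (adjPerm hP i * w))
    {w : Equiv.Perm (RankedFlag N P)} (hw : w ∈ conn hP a b) : p w := by
  refine Subgroup.closure_induction_left (p := fun x _ => p x) one ?_ ?_ hw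
  · rintro _ ⟨i, h1, h2, rfl⟩ y hy h
    exact mul i y h1 h2 hy h
  · rintro _ ⟨i, h1, h2, rfl⟩ y hy h
    rw [adjPerm_inv]
    exact mul i y h1 h2 hy h

theorem conn_induction_right (hP : IsAbstractPolytope ((N : ℤ) - 1) P) {a b : ℕ}
    {p : Equiv.Perm (RankedFlag N P) → Prop} (one : p 1)
    (mul : ∀ i w, a < i → i < b → w ∈ conn hP a b → p w → p (w * adjPerm hP i))
    {w : Equiv.Perm (RankedFlag N P)} (hw : w ∈ conn hP a b) : p w := by
  refine Subgroup.closure_induction_right (p := fun x _ => p x) one ?_ ?_ hw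
  · rintro y hy _ ⟨i, h1, h2, rfl⟩ h
    exact mul i y h1 h2 hy h
  · rintro y hy _ ⟨i, h1, h2, rfl⟩ h
    rw [adjPerm_inv]
    exact mul i y h1 h2 hy h

theorem conn_face (hP : IsAbstractPolytope ((N : ℤ) - 1) P) {a b k : ℕ} (hk : k ≤ a ∨ b ≤ k)
    {w : Equiv.Perm (RankedFlag N P)} (hw : w ∈ conn hP a b) (f : RankedFlag N P) :
    (w f).face k = f.face k := by
  refine conn_induction_left hP (p := fun w => (w f).face k = f.face k) rfl ?_ hw
  intro i w h1 h2 _ h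
  rw [Equiv.Perm.mul_apply, adjPerm_apply, adj_face _ (by omega), h]

/-- A map of faces that is injective and takes flags in `D` to flags commutes with the action of
the connection group on `D`. -/
theorem conn_map (hP : IsAbstractPolytope ((N : ℤ) - 1) P) {a b : ℕ} {φ : P → P}
    (hφ : Function.Injective φ) {D : Set (RankedFlag N P)}
    (hD : ∀ f ∈ D, ∀ i, a < i → i < b → adj i f ∈ D)
    (hex : ∀ f ∈ D, ∃ f' : RankedFlag N P, ∀ k, f'.face k = φ (f.face k))
    {w : Equiv.Perm (RankedFlag N P)} (hw : w ∈ conn hP a b) {f f' : RankedFlag N P} (hf : f ∈ D)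
    (hff' : ∀ k, f'.face k = φ (f.face k)) :
    w f ∈ D ∧ ∀ k, (w f').face k = φ ((w f).face k) := by
  refine conn_induction_left hP
    (p := fun w => w f ∈ D ∧ ∀ k, (w f').face k = φ ((w f).face k)) ⟨hf, hff'⟩ ?_ hw
  intro i w h1 h2 _ ⟨hwD, hwf⟩
  simp only [Equiv.Perm.mul_apply, adjPerm_apply]
  have hmem := hD _ hwD i h1 h2
  refine ⟨hmem, ?_⟩
  by_cases hi : 0 < i ∧ i < N
  swap
  · rwa [adj_eq_self hP _ hi, adj_eq_self hP _ hi]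
  obtain ⟨f'', hf''⟩ := hex _ hmem
  -- The image of `adj i (w f)` agrees with `w f'` off height `i`, and differs from it because `φ`
  -- is injective; uniqueness of the adjacent flag does the rest.
  have : f'' = adj i (w f') := by
    refine eq_adj hP ?_ ?_
    · rintro rfl
      apply adj_ne hP (w f) hi.1 hi.2
      exact ext_face fun k _ => hφ ((hf'' k).symm.trans (hwf k))
    · intro k hk
      rw [hf'', hwf, adj_face _ hk]
  rwa [← this]

/-- Induction on a bound `d` for `b - a`. With at most one free height the flags are equal or
adjacent. Otherwise a path supplied by strong connectivity is followed, and flags sharing a face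
strictly inside the interval reduce to two shorter intervals. -/
theorem exists_conn_of_agree (hP : IsAbstractPolytope ((N : ℤ) - 1) P) (d : ℕ) :
    ∀ {a b : ℕ} {f g : RankedFlag N P}, b ≤ a + d → a < b → b ≤ N →
      (∀ k, k ≤ a ∨ b ≤ k → f.face k = g.face k) → ∃ w ∈ conn hP a b, w f = g := by
  have hN := hP.allFlagsHaveLength
  induction d with
  | zero => intros; omega
  | succ d ih =>
    intro a b f g hd hab hb hfg
    rcases lt_trichotomy b (a + 2) with h2 | rfl | h2
    · refine ⟨1, one_mem _, ?_⟩
      exact ext_face fun k _ => hfg k (by omega)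
    · by_cases h : g = f
      · exact ⟨1, one_mem _, h.symm⟩
      · refine ⟨adjPerm hP (a + 1), adjPerm_mem_conn hP (by omega) (by omega), ?_⟩
        exact (eq_adj hP h fun k hk => (hfg k (by omega)).symm).symm
    · have common : ∀ {c : ℕ} {f g : RankedFlag N P}, a < c → c < b →
          (∀ k, k ≤ a ∨ b ≤ k → f.face k = g.face k) → f.face c = g.face c →
          ∃ w ∈ conn hP a b, w f = g := by
        intro c f g hac hcb hfg hc
        obtain ⟨e, he1, he2⟩ := exists_splice hc.symm
        obtain ⟨w, hw, hwf⟩ := ih (a := a) (b := c) (f := f) (g := e) (by omega) hac (by omega) (by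
          rintro k (hk | hk)
          · rw [he1 k (by omega), hfg k (Or.inl hk)]
          · rw [he2 k hk])
        obtain ⟨v, hv, hve⟩ := ih (a := c) (b := b) (f := e) (g := g) (by omega) hcb hb (by
          rintro k (hk | hk)
          · rw [he1 k hk]
          · rw [he2 k (by omega), hfg k (Or.inr hk)])
        refine ⟨v * w, mul_mem (conn_mono hP (by omega) le_rfl hv)
          (conn_mono hP le_rfl (by omega) hw), ?_⟩
        rw [Equiv.Perm.mul_apply, hwf, hve]
      have hfa : f.face a = g.face a := hfg a (Or.inl le_rfl)
      have hfb : f.face b = g.face b := hfg b (Or.inr le_rfl)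
      have index : ∀ {e : RankedFlag N P} {k : ℕ},
          (∀ k, k ≤ a ∨ b ≤ k → f.face k = e.face k) → f.face a < e.face k →
          e.face k < f.face b → a < k ∧ k < b := by
        intro e k he h1 h2
        rw [he a (Or.inl le_rfl)] at h1
        rw [he b (Or.inr le_rfl)] at h2
        constructor
        · by_contra h
          exact (e.face_mono (not_lt.1 h)).not_gt h1
        · by_contra h
          exact (e.face_mono (not_lt.1 h)).not_gt h2
      -- Along the path from `f.face (a + 1)`, every flag through the current face that agrees with
      -- `f` outside the interval is reachable. Consecutive faces are comparable, so some flag `h`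
      -- contains both and links the two stages.
      have step : ∀ x : Set.Ioo (f.face a) (f.face b), Relation.ReflTransGen
          (fun X Y => X ≤ Y ∨ Y ≤ X) (⟨f.face (a + 1), f.face_lt (by omega) (by omega),
            f.face_lt (by omega) hb⟩ : Set.Ioo (f.face a) (f.face b)) x →
          ∀ e : RankedFlag N P, (∀ k, k ≤ a ∨ b ≤ k → f.face k = e.face k) →
            (∃ k, e.face k = x) → ∃ w ∈ conn hP a b, w f = e := by
        intro x hx
        induction hx with
        | refl =>
          rintro e he ⟨k, hk⟩
          have hkk := index he (by rw [hk]; exact f.face_lt (by omega) (by omega))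
            (by rw [hk]; exact f.face_lt (by omega) hb)
          have := index_unique hN (by omega) (by omega) hk
          subst this
          exact common hkk.1 hkk.2 he hk.symm
        | @tail x y _ hxy ihx =>
          rintro e he ⟨k, hk⟩
          have hkk := index he (by rw [hk]; exact y.2.1) (by rw [hk]; exact y.2.2)
          obtain ⟨h, hh, ⟨l, hl, hlx⟩, ⟨m, hm, hmy⟩⟩ : ∃ h : RankedFlag N P,
              (∀ k, k ≤ a ∨ b ≤ k → h.face k = f.face k) ∧ (∃ k ≤ N, h.face k = x) ∧
              ∃ k ≤ N, h.face k = y := by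
            rcases hxy with hxy | hxy
            · exact exists_through hN f x.2.1.le hxy y.2.2.le
            · obtain ⟨h, h1, h2, h3⟩ := exists_through hN f y.2.1.le hxy x.2.2.le
              exact ⟨h, h1, h3, h2⟩
          obtain ⟨w, hw, hwf⟩ := ihx h (fun k hk => (hh k hk).symm) ⟨l, hlx⟩
          have := index_unique hN hm (by omega) (hmy.trans hk.symm)
          subst this
          obtain ⟨v, hv, hve⟩ := common hkk.1 hkk.2 (f := h) (g := e)
            (fun k hk => (hh k hk).trans (he k hk)) (hmy.trans hk.symm)
          exact ⟨v * w, mul_mem hv hw, by rw [Equiv.Perm.mul_apply, hwf, hve]⟩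
      have hr : 3 ≤ faceRank (f.face b) - faceRank (f.face a) := by
        rw [f.faceRank_face hN hb, f.faceRank_face hN (by omega)]
        omega
      refine step ⟨g.face (a + 1), ?_, ?_⟩
        (hP.strongly_connected _ _ (f.face_lt hab hb) hr _ _) g hfg ⟨a + 1, rfl⟩
      · rw [hfa]
        exact g.face_lt (by omega) (by omega)
      · rw [hfb]
        exact g.face_lt (by omega) (by omega)

end RankedFlag

/-! ### From free action to regularity. -/

namespace RankedFlag

variable {N : ℕ} {P : Type*} [PartialOrder P] [BoundedOrder P]

theorem exists_conn_of_agree' (hP : IsAbstractPolytope ((N : ℤ) - 1) P) {a b : ℕ}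
    {f g : RankedFlag N P} (hab : a ≤ b) (hb : b ≤ N)
    (h : ∀ k, k ≤ a ∨ b ≤ k → f.face k = g.face k) : ∃ w ∈ conn hP a b, w f = g := by
  rcases hab.eq_or_lt with rfl | hab
  · exact ⟨1, one_mem _, ext_face fun k _ => h k (le_total _ _)⟩
  · exact exists_conn_of_agree hP b (by omega) hab hb h

theorem exists_conn_eq (hP : IsAbstractPolytope ((N : ℤ) - 1) P) (f g : RankedFlag N P) :
    ∃ w ∈ conn hP 0 N, w f = g := by
  have hN := hP.allFlagsHaveLength
  refine exists_conn_of_agree' hP (Nat.zero_le N) le_rfl ?_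
  rintro k (hk | hk)
  · rw [Nat.le_zero.1 hk, face_zero hN, face_zero hN]
  · rw [face_top _ hk, face_top _ hk]

/-- A map of flags commuting with all adjacencies is induced by a monotone map of faces. -/
theorem exists_monotone_of_commute (hP : IsAbstractPolytope ((N : ℤ) - 1) P)
    {T : RankedFlag N P → RankedFlag N P}
    (hT : ∀ f i, 0 < i → i < N → T (adj i f) = adj i (T f)) :
    ∃ φ : P → P, Monotone φ ∧ ∀ f k, φ (face f k) = (T f).face k := by
  have hN := hP.allFlagsHaveLength
  have hTw : ∀ {a b : ℕ}, b ≤ N → ∀ w ∈ conn hP a b, ∀ f, T (w f) = w (T f) := by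
    intro a b hb w hw f
    refine conn_induction_left hP (p := fun w => T (w f) = w (T f)) rfl ?_ hw
    intro i w h1 h2 _ h
    simp only [Equiv.Perm.mul_apply, adjPerm_apply]
    rw [hT _ _ (by omega) (by omega), h]
  -- Flags sharing the face of height `k` are related by elements of `conn k N` and `conn 0 k`.
  -- These commute with `T` and preserve faces of height `k`, so the face of `T f` at height `k`
  -- depends only on `f.face k`.
  have wd : ∀ f g : RankedFlag N P, ∀ k ≤ N, f.face k = g.face k →
      (T f).face k = (T g).face k := by
    intro f g k hk h
    obtain ⟨e, he1, he2⟩ := exists_splice h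
    obtain ⟨w, hw, hwf⟩ := exists_conn_of_agree' hP (f := f) (g := e) hk le_rfl (by
      rintro l (hl | hl)
      · exact (he1 l hl).symm
      · rw [face_top _ hl, face_top _ hl])
    obtain ⟨v, hv, hve⟩ := exists_conn_of_agree' hP (f := e) (g := g) (Nat.zero_le k) hk (by
      rintro l (hl | hl)
      · rw [Nat.le_zero.1 hl, face_zero hN, face_zero hN]
      · exact he2 l hl)
    rw [← hve, ← hwf, hTw hk v hv, hTw le_rfl w hw, conn_face hP (Or.inr le_rfl) hv,
      conn_face hP (Or.inl le_rfl) hw]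
  choose F K hK hFK using fun x : P => exists_face_eq hN x
  have key : ∀ f k, (T (F (face f k))).face (K (face f k)) = (T f).face k := by
    have key' : ∀ f k, k ≤ N → (T (F (face f k))).face (K (face f k)) = (T f).face k := by
      intro f k hk
      have h := hFK (f.face k)
      have hk' := index_unique hN (hK _) hk h
      rw [hk'] at h ⊢
      exact wd _ _ k hk h
    intro f k
    rcases le_total k N with hk | hk
    · exact key' f k hk
    · have := key' f N le_rfl
      rw [face_top f hk, face_top (T f) hk]
      rwa [face_top f le_rfl, face_top (T f) le_rfl] at this
  refine ⟨fun x => (T (F x)).face (K x), ?_, key⟩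
  intro x y hxy
  obtain ⟨g, hg⟩ := exists_of_isChain hN (IsChain.pair hxy)
  obtain ⟨k, hk, rfl⟩ := hg x (by simp)
  obtain ⟨l, hl, rfl⟩ := hg y (by simp)
  simp only [key]
  rcases le_or_gt k l with h | h
  · exact (T g).face_mono h
  · exact absurd hxy (g.face_lt h hk).not_ge

theorem exists_orderIso_of_commute (hP : IsAbstractPolytope ((N : ℤ) - 1) P)
    {T T' : RankedFlag N P → RankedFlag N P}
    (hT : ∀ f i, 0 < i → i < N → T (adj i f) = adj i (T f))
    (hT' : ∀ f i, 0 < i → i < N → T' (adj i f) = adj i (T' f))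
    (h : ∀ f, T' (T f) = f) (h' : ∀ f, T (T' f) = f) :
    ∃ γ : P ≃o P, ∀ f k, (T f).face k = γ (face f k) := by
  have hN := hP.allFlagsHaveLength
  obtain ⟨φ, hφ, hφT⟩ := exists_monotone_of_commute hP hT
  obtain ⟨ψ, hψ, hψT⟩ := exists_monotone_of_commute hP hT'
  have hl : ∀ x, ψ (φ x) = x := by
    intro x
    obtain ⟨f, k, -, rfl⟩ := exists_face_eq hN x
    rw [hφT, hψT, h]
  have hr : ∀ x, φ (ψ x) = x := by
    intro x
    obtain ⟨f, k, -, rfl⟩ := exists_face_eq hN x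
    rw [hψT, hφT, h']
  refine ⟨⟨⟨φ, ψ, hl, hr⟩, ?_⟩, fun f k => (hφT f k).symm⟩
  intro x y
  refine ⟨fun hxy => ?_, fun hxy => hφ hxy⟩
  have := hψ hxy
  simpa only [Equiv.coe_fn_mk, hl] using this

/-- If the connection group acts freely on the flags, the automorphism group is transitive. -/
theorem exists_orderIso_of_free (hP : IsAbstractPolytope ((N : ℤ) - 1) P)
    (hfree : ∀ w ∈ conn hP 0 N, ∀ f, w f = f → w = 1) (Φ Ψ : RankedFlag N P) :
    ∃ γ : P ≃o P, ∀ k, Ψ.face k = γ (Φ.face k) := by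
  have huniq : ∀ w ∈ conn hP 0 N, ∀ v ∈ conn hP 0 N, ∀ f, w f = v f → w = v := by
    intro w hw v hv f h
    have := hfree (v⁻¹ * w) (mul_mem (inv_mem hv) hw) f (by
      rw [Equiv.Perm.mul_apply, h, ← Equiv.Perm.mul_apply, inv_mul_cancel, Equiv.Perm.one_apply])
    exact (inv_mul_eq_one.1 this).symm
  -- `W Φ f` takes `Φ` to `f`, and freeness makes it the only such element. The required
  -- automorphism is induced by `w Φ ↦ w Ψ`, that is, `f ↦ W Φ f Ψ`.
  choose W hW hWf using exists_conn_eq hP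
  have comm : ∀ Φ Ψ f : RankedFlag N P, ∀ i, 0 < i → i < N →
      W Φ (adj i f) Ψ = adj i (W Φ f Ψ) := by
    intro Φ Ψ f i h0 hi
    have : W Φ (adj i f) = adjPerm hP i * W Φ f := by
      refine huniq _ (hW _ _) _ (mul_mem (adjPerm_mem_conn hP h0 hi) (hW _ _)) Φ ?_
      rw [hWf, Equiv.Perm.mul_apply, hWf, adjPerm_apply]
    rw [this, Equiv.Perm.mul_apply, adjPerm_apply]
  have inv : ∀ Φ Ψ f : RankedFlag N P, W Ψ (W Φ f Ψ) Φ = f := by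
    intro Φ Ψ f
    rw [huniq _ (hW Ψ (W Φ f Ψ)) _ (hW Φ f) Ψ (hWf _ _), hWf]
  obtain ⟨γ, hγ⟩ := exists_orderIso_of_commute hP (T := fun f => W Φ f Ψ)
    (T' := fun f => W Ψ f Φ) (comm Φ Ψ) (comm Ψ Φ) (inv Φ Ψ) (inv Ψ Φ)
  refine ⟨γ, fun k => ?_⟩
  rw [← hγ, hfree (W Φ Φ) (hW _ _) Φ (hWf _ _), Equiv.Perm.one_apply]

/-! ### Orbits of flags and chirality. -/

theorem sameFlagOrbit_iff (hN : AllFlagsHaveLength N P) (f g : RankedFlag N P) :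
    SameFlagOrbit (f.toFlag hN) (g.toFlag hN) ↔ ∃ γ : P ≃o P, ∀ k, g.face k = γ (f.face k) := by
  constructor
  · rintro ⟨γ, hγ⟩
    refine ⟨γ, ?_⟩
    let f' : RankedFlag N P :=
      { face := fun k => γ (f.face k)
        face_lt := fun h hl => γ.strictMono (f.face_lt h hl)
        face_top := fun hk => by rw [f.face_top hk, map_top] }
    have : f' = g := by
      refine ext_of_range_subset hN fun k _ => ?_
      have : γ (f.face k) ∈ (Flag.map γ (f.toFlag hN) : Set P) := ⟨_, ⟨k, rfl⟩, rfl⟩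
      rwa [hγ] at this
    intro k
    rw [← this]
  · rintro ⟨γ, hγ⟩
    refine ⟨γ, Flag.ext ?_⟩
    rw [Flag.coe_map, coe_toFlag, coe_toFlag, ← Set.range_comp]
    congr 1
    funext k
    exact (hγ k).symm

theorem encard_range_diff (hN : AllFlagsHaveLength N P) {f g : RankedFlag N P} {i : ℕ} (hi : i ≤ N)
    (hne : f.face i ≠ g.face i) (h : ∀ k, k ≠ i → g.face k = f.face k) :
    (Set.range f.face \ Set.range g.face).encard = 1 := by
  rw [Set.encard_eq_one]
  refine ⟨f.face i, ?_⟩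
  ext x
  simp only [Set.mem_sdiff, Set.mem_singleton_iff]
  constructor
  · rintro ⟨⟨k, rfl⟩, hx⟩
    by_cases hk : k = i
    · rw [hk]
    · exact absurd ⟨k, h k hk⟩ hx
  · rintro rfl
    refine ⟨⟨i, rfl⟩, ?_⟩
    rw [range_eq_image]
    rintro ⟨l, hl, hli⟩
    have := index_unique hN hl hi hli
    subst this
    exact hne hli.symm

theorem flagAdjacent_adj (hP : IsAbstractPolytope ((N : ℤ) - 1) P) (f : RankedFlag N P) {i : ℕ}
    (h0 : 0 < i) (hi : i < N) :
    FlagAdjacent (f.toFlag hP.allFlagsHaveLength) ((adj i f).toFlag hP.allFlagsHaveLength) := by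
  have hne := face_ne_of_ne (adj_ne hP f h0 hi) fun k hk => adj_face f hk
  exact ⟨encard_range_diff hP.allFlagsHaveLength hi.le hne.symm fun k hk => adj_face f hk,
    encard_range_diff hP.allFlagsHaveLength hi.le hne fun k hk => (adj_face f hk).symm⟩

theorem _root_.SameFlagOrbit.symm {Q : Type*} [PartialOrder Q] {Φ Ψ : Flag Q}
    (h : SameFlagOrbit Φ Ψ) : SameFlagOrbit Ψ Φ := by
  obtain ⟨γ, rfl⟩ := h
  exact ⟨γ.symm, (Flag.map γ).symm_apply_apply Φ⟩

theorem _root_.SameFlagOrbit.trans {Q : Type*} [PartialOrder Q] {Φ Ψ Θ : Flag Q}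
    (h : SameFlagOrbit Φ Ψ) (h' : SameFlagOrbit Ψ Θ) : SameFlagOrbit Φ Θ := by
  obtain ⟨γ, rfl⟩ := h
  obtain ⟨δ, rfl⟩ := h'
  refine ⟨γ.trans δ, Flag.ext ?_⟩
  simp [Set.image_image]

/-- In a chiral polytope, every flag is equivalent to a given flag or to a given one of its
adjacent flags. -/
theorem exists_orderIso_of_chiral (hP : IsAbstractPolytope ((N : ℤ) - 1) P)
    (hc : IsChiralPolytope P) {i : ℕ} (h0 : 0 < i) (hi : i < N) (f g : RankedFlag N P) :
    ∃ γ : P ≃o P, (∀ k, g.face k = γ (f.face k)) ∨ ∀ k, g.face k = γ ((adj i f).face k) := by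
  have hN := hP.allFlagsHaveLength
  obtain ⟨⟨Φ₁, Φ₂, -, hall⟩, hadj⟩ := hc
  have hne := hadj _ _ (flagAdjacent_adj hP f h0 hi)
  suffices SameFlagOrbit (f.toFlag hN) (g.toFlag hN) ∨
      SameFlagOrbit ((adj i f).toFlag hN) (g.toFlag hN) by
    rw [sameFlagOrbit_iff, sameFlagOrbit_iff] at this
    rcases this with ⟨γ, hγ⟩ | ⟨γ, hγ⟩
    · exact ⟨γ, Or.inl hγ⟩
    · exact ⟨γ, Or.inr hγ⟩
  -- Pigeonhole: `f` and `adj i f` lie in different orbits, so they represent both.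
  rcases hall (f.toFlag hN) with hf | hf <;> rcases hall ((adj i f).toFlag hN) with ha | ha <;>
    rcases hall (g.toFlag hN) with hg | hg
  · exact absurd (hf.symm.trans ha) hne
  · exact absurd (hf.symm.trans ha) hne
  · exact Or.inl (hf.symm.trans hg)
  · exact Or.inr (ha.symm.trans hg)
  · exact Or.inr (ha.symm.trans hg)
  · exact Or.inl (hf.symm.trans hg)
  · exact absurd (hf.symm.trans ha) hne
  · exact absurd (hf.symm.trans ha) hne

/-! ### Regular sections of a chiral polytope. -/

/-- All proper faces of the flag `f` lie in `S`. -/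
def ProperFacesIn (S : Set P) (f : RankedFlag N P) : Prop :=
  ∀ k, f.face k ∈ S ∨ f.face k = ⊥ ∨ f.face k = ⊤

/-- An element of `S` comparable with all faces of `f` in `S` is comparable with all of `f`, since
the missing faces can only be `⊥` or `⊤`; so it belongs to `f`. -/
theorem isMaxChain_section (hN : AllFlagsHaveLength N P) {S : Set P} {f : RankedFlag N P}
    (hf : ProperFacesIn S f) : IsMaxChain (· ≤ ·) {x : S | (x : P) ∈ Set.range f.face} := by
  constructor
  · intro x hx y hy hxy
    exact f.isChain_range hx hy (Subtype.coe_ne_coe.2 hxy)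
  · intro t ht hsub
    refine hsub.antisymm fun x hx => ?_
    change (x : P) ∈ f.toFlag hN
    rw [Flag.mem_iff_forall_le_or_ge]
    rintro _ ⟨k, rfl⟩
    rcases hf k with h | h | h
    · exact ht.total hx (hsub (show (⟨f.face k, h⟩ : S) ∈ _ from ⟨k, rfl⟩))
    · exact Or.inr (h ▸ bot_le)
    · exact Or.inl (h ▸ le_top)

open Classical in
/-- An automorphism of a regular section taking one flag to another, extended by the identity. -/
theorem exists_section_map (hN : AllFlagsHaveLength N P) {S : Set P} (hS : IsRegularPolytope S)
    {f f' : RankedFlag N P} (hf : ProperFacesIn S f) (hf' : ProperFacesIn S f') :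
    ∃ φ : P → P, Function.Injective φ ∧
      (∀ e : RankedFlag N P, ProperFacesIn S e →
        ∃ e' : RankedFlag N P, ∀ k, e'.face k = φ (e.face k)) ∧
      ∀ k, f'.face k = φ (f.face k) := by
  obtain ⟨γ, hγ⟩ := hS (Flag.ofIsMaxChain _ (isMaxChain_section hN hf))
    (Flag.ofIsMaxChain _ (isMaxChain_section hN hf'))
  -- This extension need not be monotone on `P`. It fixes `⊥` and `⊤`, whether or not they lie in
  -- `S`, and this suffices to send flags with proper faces in `S` to flags.
  let φ : P → P := fun x => if h : x ∈ S then γ ⟨x, h⟩ else x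
  have hφS : ∀ x (h : x ∈ S), φ x = γ ⟨x, h⟩ := fun x h => dif_pos h
  have hφS' : ∀ x, x ∉ S → φ x = x := fun x h => dif_neg h
  have hmem : ∀ x, x ∈ S → φ x ∈ S := fun x h => by
    rw [hφS x h]
    exact Subtype.coe_prop _
  have hinj : Function.Injective φ := by
    intro x y hxy
    by_cases hx : x ∈ S <;> by_cases hy : y ∈ S
    · rw [hφS x hx, hφS y hy] at hxy
      exact congrArg Subtype.val (γ.injective (Subtype.ext hxy))
    · rw [hφS' y hy] at hxy
      exact absurd (hxy ▸ hmem x hx) hy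
    · rw [hφS' x hx] at hxy
      exact absurd (hxy ▸ hmem y hy) hx
    · rwa [hφS' x hx, hφS' y hy] at hxy
  have htop : φ ⊤ = ⊤ := by
    by_cases h : (⊤ : P) ∈ S
    · rw [hφS _ h]
      obtain ⟨y, hy⟩ := γ.surjective ⟨⊤, h⟩
      have : γ y ≤ γ ⟨⊤, h⟩ := γ.monotone (Subtype.coe_le_coe.1 le_top)
      rw [hy] at this
      exact top_le_iff.1 (Subtype.coe_le_coe.2 this)
    · exact hφS' _ h
  have hbot : φ ⊥ = ⊥ := by
    by_cases h : (⊥ : P) ∈ S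
    · rw [hφS _ h]
      obtain ⟨y, hy⟩ := γ.surjective ⟨⊥, h⟩
      have : γ ⟨⊥, h⟩ ≤ γ y := γ.monotone (Subtype.coe_le_coe.1 bot_le)
      rw [hy] at this
      exact le_bot_iff.1 (Subtype.coe_le_coe.2 this)
    · exact hφS' _ h
  have hex : ∀ e : RankedFlag N P, ProperFacesIn S e →
      ∃ e' : RankedFlag N P, ∀ k, e'.face k = φ (e.face k) := by
    intro e he
    refine ⟨⟨fun k => φ (e.face k), ?_, ?_⟩, fun _ => rfl⟩
    · intro k l hkl hl
      have hlt := e.face_lt hkl hl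
      rcases he k with hk | hk | hk
      · rcases he l with hl | hl | hl
        · rw [hφS _ hk, hφS _ hl]
          exact Subtype.coe_lt_coe.2 (γ.strictMono (Subtype.coe_lt_coe.1 hlt))
        · exact absurd hlt (hl ▸ not_lt_bot)
        · rw [hl, htop, lt_top_iff_ne_top]
          intro h
          exact hlt.ne (hinj (h.trans (htop.symm.trans (congrArg φ hl.symm))))
      · rw [hk, hbot, bot_lt_iff_ne_bot]
        intro h
        exact hlt.ne' (hinj (h.trans (hbot.symm.trans (congrArg φ hk.symm))))
      · exact absurd hlt (hk ▸ not_top_lt)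
    · intro k hk
      rw [e.face_top hk, htop]
  refine ⟨φ, hinj, hex, ?_⟩
  obtain ⟨e', he'⟩ := hex f hf
  have : e' = f' := by
    refine ext_of_range_subset hN fun k _ => ?_
    rw [he']
    rcases hf k with h | h | h
    · have : γ ⟨f.face k, h⟩ ∈ (Flag.map γ (Flag.ofIsMaxChain _ (isMaxChain_section hN hf)) : Set S) :=
        ⟨_, ⟨k, rfl⟩, rfl⟩
      rw [hγ] at this
      rw [hφS _ h]
      exact this
    · exact ⟨0, by rw [h, hbot, f'.face_zero hN]⟩
    · exact ⟨N, by rw [h, htop, f'.face_top le_rfl]⟩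
  exact fun k => this ▸ he' k

/-- In a chiral polytope, an element of the connection group of a regular section that fixes one
flag fixes all flags. -/
theorem conn_eq_one_of_section (hP : IsAbstractPolytope ((N : ℤ) - 1) P)
    (hc : IsChiralPolytope P) {a b i : ℕ} (ha : a < i) (hb : i < b) (h0 : 0 < i) (hi : i < N)
    {S : Set P} (hS : IsRegularPolytope S) {D : Set (RankedFlag N P)}
    (hD : ∀ f ∈ D, ∀ i, a < i → i < b → adj i f ∈ D) (hDS : ∀ f ∈ D, ProperFacesIn S f)
    {w : Equiv.Perm (RankedFlag N P)} (hw : w ∈ conn hP a b) {f : RankedFlag N P} (hf : f ∈ D)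
    (hwf : w f = f) : w = 1 := by
  have hauto : ∀ (γ : P ≃o P) (e g : RankedFlag N P), w e = e →
      (∀ k, g.face k = γ (e.face k)) → w g = g := by
    intro γ e g he hg
    have := conn_map hP γ.injective (D := Set.univ) (fun _ _ _ _ _ => trivial)
      (fun e _ => ⟨⟨fun k => γ (e.face k), fun h hl => γ.strictMono (e.face_lt h hl),
        fun hk => by rw [e.face_top hk, map_top]⟩, fun _ => rfl⟩) hw (f := e) trivial hg
    refine ext_face fun k _ => ?_
    rw [this.2, he, hg]
  -- An automorphism of the section takes `f` to `adj i f` and commutes with `w` on `D`, so the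
  -- fixed flag `f` yields a second one, in the other orbit.
  have hwa : w (adj i f) = adj i f := by
    have haD := hD f hf i ha hb
    obtain ⟨φ, hφ, hex, hφf⟩ := exists_section_map hP.allFlagsHaveLength hS (hDS f hf) (hDS _ haD)
    have := conn_map hP hφ hD (fun e he => hex e (hDS e he)) hw hf hφf
    refine ext_face fun k _ => ?_
    rw [this.2, hwf, hφf]
  ext1 g
  obtain ⟨γ, hγ | hγ⟩ := exists_orderIso_of_chiral hP hc h0 hi f g
  · exact hauto γ f g hwf hγ
  · exact hauto γ _ g hwa hγ

/-! ### Flatness and factorization of the connection group. -/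

theorem faceRank_Iic (hN : AllFlagsHaveLength N P) (f : RankedFlag N P) {k : ℕ} (hk : k ≤ N) {F : P}
    (h : f.face k ≤ F) : faceRank (⟨f.face k, h⟩ : Set.Iic F) = (k : ℤ) - 1 := by
  have : Order.height (⟨f.face k, h⟩ : Set.Iic F) = k := by
    apply le_antisymm
    · have := Order.height_le_height_apply_of_strictMono (Subtype.val : Set.Iic F → P)
        (fun _ _ h => h) ⟨f.face k, h⟩
      rwa [f.height_face hN hk] at this
    · let p : LTSeries (Set.Iic F) :=
        { length := k
          toFun := fun i => ⟨f.face i, (f.face_mono (by omega)).trans h⟩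
          step := fun i => Subtype.coe_lt_coe.1 (f.face_lt (by simp) (by simp; omega)) }
      exact Order.length_le_height (p := p) le_rfl
  rw [faceRank, this]
  rfl

/-- By flatness the ridge of `f` (height `N - 2`) is incident with the vertex of `a f`, so some flag
`e` of the same facet contains both. Moving `f` to `e` keeps the ridge, which gives `d`; moving `e`
to `a f` keeps the vertex, which gives `c`. Freeness turns `c (d f) = a f` into `a = c * d`. -/
theorem exists_factor_facet (hP : IsAbstractPolytope ((N : ℤ) - 1) P) (hN3 : 3 ≤ N)
    (hfacet : ∀ a ∈ conn hP 0 (N - 1), ∀ f, a f = f → a = 1) (f : RankedFlag N P)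
    (hflat : IsFlatPolytope ((N : ℤ) - 2) (Set.Iic (f.face (N - 1))))
    {a : Equiv.Perm (RankedFlag N P)} (ha : a ∈ conn hP 0 (N - 1)) :
    ∃ c ∈ conn hP 1 (N - 1), ∃ d ∈ conn hP 0 (N - 2), a = c * d := by
  have hN := hP.allFlagsHaveLength
  have haF : (a f).face (N - 1) = f.face (N - 1) := conn_face hP (Or.inr le_rfl) ha f
  have hR : f.face (N - 2) ≤ f.face (N - 1) := f.face_mono (by omega)
  have hu : (a f).face 1 ≤ f.face (N - 1) := haF ▸ (a f).face_mono (by omega)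
  have hcomp := hflat ⟨_, hR⟩ ⟨_, hu⟩ (by rw [faceRank_Iic hN f (by omega)]; omega)
    (by rw [faceRank_Iic hN _ (by omega)]; rfl)
  obtain ⟨e, he, ⟨k, hk, hek⟩, ⟨l, hl, hel⟩⟩ : ∃ e : RankedFlag N P,
      (∀ k, k ≤ 0 ∨ N - 1 ≤ k → e.face k = f.face k) ∧
      (∃ k ≤ N, e.face k = (a f).face 1) ∧ ∃ k ≤ N, e.face k = f.face (N - 2) := by
    have hbot : ∀ x, f.face 0 ≤ x := fun x => (f.face_zero hN).trans_le bot_le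
    rcases hcomp with h | h
    · exact exists_through hN f (hbot _) h hR
    · obtain ⟨e, h1, h2, h3⟩ := exists_through hN f (hbot _) h hu
      exact ⟨e, h1, h3, h2⟩
  have := index_unique hN hk (by omega) hek
  subst this
  have := index_unique hN hl (by omega) hel
  subst this
  obtain ⟨d, hd, hdf⟩ := exists_conn_of_agree' hP (a := 0) (b := N - 2) (f := f) (g := e)
    (by omega) (by omega) (by
      rintro k (hk | hk)
      · exact (he k (Or.inl hk)).symm
      · rcases hk.eq_or_lt with rfl | hk
        · exact hel.symm
        · exact (he k (by omega)).symm)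
  obtain ⟨c, hc, hce⟩ := exists_conn_of_agree' hP (a := 1) (b := N - 1) (f := e) (g := a f)
    (by omega) (by omega) (by
      rintro k (hk | hk)
      · obtain rfl | rfl : k = 0 ∨ k = 1 := by omega
        · rw [face_zero hN, face_zero hN]
        · exact hek
      · rw [he k (Or.inr hk), conn_face hP (Or.inr hk) ha])
  refine ⟨c, hc, d, hd, ?_⟩
  have hcd : c * d ∈ conn hP 0 (N - 1) :=
    mul_mem (conn_mono hP (by omega) le_rfl hc) (conn_mono hP le_rfl (by omega) hd)
  have := hfacet ((c * d)⁻¹ * a) (mul_mem (inv_mem hcd) ha) f (by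
    rw [Equiv.Perm.mul_apply, ← hce, ← hdf, ← Equiv.Perm.mul_apply c, ← Equiv.Perm.mul_apply,
      inv_mul_cancel, Equiv.Perm.one_apply])
  exact (inv_mul_eq_one.1 this).symm

/-- The product set is closed under right multiplication by generators: those below height `N - 1`
are absorbed by refactoring in the facet group, and `r_{N-1}` moves past `d`. -/
theorem exists_factor (hP : IsAbstractPolytope ((N : ℤ) - 1) P) (hN3 : 3 ≤ N)
    (hfactor : ∀ a ∈ conn hP 0 (N - 1), ∃ c ∈ conn hP 1 (N - 1), ∃ d ∈ conn hP 0 (N - 2),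
      a = c * d)
    {w : Equiv.Perm (RankedFlag N P)} (hw : w ∈ conn hP 0 N) :
    ∃ b ∈ conn hP 1 N, ∃ d ∈ conn hP 0 (N - 2), w = b * d := by
  refine conn_induction_right hP
    (p := fun w => ∃ b ∈ conn hP 1 N, ∃ d ∈ conn hP 0 (N - 2), w = b * d)
    ⟨1, one_mem _, 1, one_mem _, by simp⟩ ?_ hw
  rintro i _ h0 hi _ ⟨b, hb, d, hd, rfl⟩
  rcases Nat.lt_or_ge i (N - 1) with h | h
  · obtain ⟨c, hc, d', hd', hcd⟩ := hfactor (d * adjPerm hP i)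
      (mul_mem (conn_mono hP le_rfl (by omega) hd) (adjPerm_mem_conn hP h0 h))
    exact ⟨b * c, mul_mem hb (conn_mono hP le_rfl (by omega) hc), d', hd', by
      rw [mul_assoc, hcd, mul_assoc]⟩
  · have hcomm : d * adjPerm hP i = adjPerm hP i * d := by
      refine conn_induction_left hP (p := fun d => d * adjPerm hP i = adjPerm hP i * d)
        (by simp) ?_ hd
      intro j d h1 h2 _ h
      have : adjPerm hP j * adjPerm hP i = adjPerm hP i * adjPerm hP j := by
        ext1 f
        exact adj_comm hP h1 (by omega) hi f
      rw [mul_assoc, h, ← mul_assoc, this, mul_assoc]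
    exact ⟨b * adjPerm hP i, mul_mem hb (adjPerm_mem_conn hP (by omega) hi), d, hd, by
      rw [mul_assoc, hcomm, mul_assoc]⟩

theorem conn_eq_one_of_factor (hP : IsAbstractPolytope ((N : ℤ) - 1) P) (hN3 : 3 ≤ N)
    (hfacet : ∀ a ∈ conn hP 0 (N - 1), ∀ f, a f = f → a = 1)
    (hvertex : ∀ b ∈ conn hP 1 N, ∀ f, b f = f → b = 1)
    (hfactor : ∀ w ∈ conn hP 0 N, ∃ b ∈ conn hP 1 N, ∃ d ∈ conn hP 0 (N - 2), w = b * d)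
    {w : Equiv.Perm (RankedFlag N P)} (hw : w ∈ conn hP 0 N) {f : RankedFlag N P}
    (hwf : w f = f) : w = 1 := by
  obtain ⟨b, hb, d, hd, rfl⟩ := hfactor w hw
  have hd' : d ∈ conn hP 0 (N - 1) := conn_mono hP le_rfl (by omega) hd
  have hbd : b (d f) = f := hwf
  -- The vertices agree because `b` preserves them and `b (d f) = f`; the facets agree because `d`
  -- preserves them.
  obtain ⟨c, hc, hcf⟩ := exists_conn_of_agree' hP (a := 1) (b := N - 1) (f := f) (g := d f)
    (by omega) (by omega) (by
      rintro k (hk | hk)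
      · conv_lhs => rw [← hbd]
        exact conn_face hP (Or.inl hk) hb _
      · exact (conn_face hP (Or.inr (by omega)) hd f).symm)
  have h1 := hfacet (c⁻¹ * d)
    (mul_mem (inv_mem (conn_mono hP (by omega) le_rfl hc)) hd') f (by
      rw [Equiv.Perm.mul_apply, ← hcf, ← Equiv.Perm.mul_apply, inv_mul_cancel,
        Equiv.Perm.one_apply])
  have h2 := hvertex (b * c) (mul_mem hb (conn_mono hP le_rfl (by omega) hc)) f (by
    rw [Equiv.Perm.mul_apply, hcf, hbd])
  rw [← inv_mul_eq_one.1 h1, h2]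

theorem not_isChiralPolytope_of_free (hP : IsAbstractPolytope ((N : ℤ) - 1) P)
    (hfree : ∀ w ∈ conn hP 0 N, ∀ f, w f = f → w = 1) : ¬IsChiralPolytope P := by
  have hN := hP.allFlagsHaveLength
  rintro ⟨⟨Φ₁, Φ₂, hne, -⟩, -⟩
  obtain ⟨f, rfl⟩ := exists_toFlag_eq hN Φ₁
  obtain ⟨g, rfl⟩ := exists_toFlag_eq hN Φ₂
  exact hne ((sameFlagOrbit_iff hN f g).2 (exists_orderIso_of_free hP hfree f g))

/-- There is at most one generator, an involution without fixed flags. -/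
theorem free_of_le_two (hP : IsAbstractPolytope ((N : ℤ) - 1) P) (hN2 : N ≤ 2) :
    ∀ w ∈ conn hP 0 N, ∀ f, w f = f → w = 1 := by
  intro w hw f hwf
  rcases hN2.eq_or_lt with rfl | hN2
  · have : w = 1 ∨ w = adjPerm hP 1 := by
      refine conn_induction_left hP (p := fun w => w = 1 ∨ w = adjPerm hP 1) (Or.inl rfl) ?_ hw
      intro i w h1 h2 _ h
      obtain rfl : i = 1 := by omega
      rcases h with rfl | rfl
      · exact Or.inr (mul_one _)
      · left
        nth_rw 1 [← adjPerm_inv]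
        exact inv_mul_cancel _
    rcases this with rfl | rfl
    · rfl
    · exact absurd hwf (adj_ne hP f one_pos one_lt_two)
  · refine conn_induction_left hP (p := fun w => w = 1) rfl ?_ hw
    intro i w h1 h2
    omega

end RankedFlag

/-! ### Conclusion. -/

open RankedFlag in
theorem mainTheorem1 (n : ℤ) (P : Type*) [PartialOrder P] [BoundedOrder P]
    (hP : IsAbstractPolytope n P) (hchiral : IsChiralPolytope P) :
    ¬ ((∀ F : P, faceRank F = n - 1 →
          Finite (Set.Iic F) ∧ IsRegularPolytope (Set.Iic F) ∧
            IsFlatPolytope (n - 1) (Set.Iic F)) ∧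
        (∀ v : P, faceRank v = 0 →
          Finite (Set.Ici v) ∧ IsRegularPolytope (Set.Ici v))) := by
  rintro ⟨hF, hv⟩
  obtain ⟨N, rfl⟩ : ∃ N : ℕ, n = (N : ℤ) - 1 := by
    obtain ⟨Φ, -⟩ := hchiral.1
    obtain ⟨hfin, hcard⟩ := hP.flag_card Φ
    have : 0 < (Φ : Set P).ncard := (Set.ncard_pos hfin).2 ⟨⊥, Φ.bot_mem⟩
    exact ⟨(Φ : Set P).ncard - 1, by omega⟩
  have hN := hP.allFlagsHaveLength
  refine not_isChiralPolytope_of_free hP ?_ hchiral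
  rcases Nat.lt_or_ge 2 N with hN3 | hN2
  swap
  · exact free_of_le_two hP hN2
  have hF' : ∀ f : RankedFlag N P, faceRank (f.face (N - 1)) = (N : ℤ) - 1 - 1 := by
    intro f
    rw [f.faceRank_face hN (by omega)]
    omega
  have hfacet : ∀ a ∈ conn hP 0 (N - 1), ∀ f, a f = f → a = 1 := by
    intro a ha f haf
    -- Any height strictly inside the section would do; `1 < N - 1` holds because `N ≥ 3`. Here `D`
    -- is the set of flags through the facet of `f`.
    refine conn_eq_one_of_section hP hchiral (i := 1) (by omega) (by omega) one_pos (by omega)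
      (hF _ (hF' f)).2.1 (D := {e | e.face (N - 1) = f.face (N - 1)}) ?_ ?_ ha rfl haf
    · intro e he i _ hi
      exact (adj_face e (by omega)).trans he
    · intro e he k
      rcases Nat.lt_or_ge k N with hk | hk
      · exact Or.inl ((e.face_mono (by omega)).trans_eq he)
      · exact Or.inr (Or.inr (e.face_top hk))
  have hvertex : ∀ b ∈ conn hP 1 N, ∀ f, b f = f → b = 1 := by
    intro b hb f hbf
    refine conn_eq_one_of_section hP hchiral (i := 2) (by omega) (by omega) two_pos (by omega)
      (hv (f.face 1) (by rw [f.faceRank_face hN (by omega)]; rfl)).2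
      (D := {e | e.face 1 = f.face 1}) ?_ ?_ hb rfl hbf
    · intro e he i hi _
      exact (adj_face e (by omega)).trans he
    · intro e he k
      rcases Nat.eq_zero_or_pos k with rfl | hk
      · exact Or.inr (Or.inl (e.face_zero hN))
      · exact Or.inl (he.symm.trans_le (e.face_mono hk))
  intro w hw f hwf
  refine conn_eq_one_of_factor hP hN3 hfacet hvertex (fun w hw => exists_factor hP hN3 ?_ hw) hw hwf
  intro a ha
  refine exists_factor_facet hP hN3 hfacet f ?_ ha
  have := (hF _ (hF' f)).2.2
  rwa [show (N : ℤ) - 1 - 1 = N - 2 by ring] at this
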